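/- Let $v,a,t_f>0$ and $x_0,y_0,\theta_0\in\mathbb R$. Consider the problem (P3) of minimizing $\varphi(s(t_f))$, where $\varphi(s):=z_3^2-z_1z_2$, over all pairs $(s,u)$ with state $s=(x,y,\theta,z_1,z_2,z_3)\in W^{1,2}([0,t_f];\mathbb R^6)$ and control $u\in L^\infty([0,t_f];\mathbb R)$ such that, for a.e. $t\in[0,t_f]$, $$\dot x=v\cos\theta,\quad \dot y=v\sin\theta,\quad \dot\theta=\frac uv,\quad \dot z_1=\frac{x^2}{(x^2+y^2)^2},\quad \dot z_2=\frac{y^2}{(x^2+y^2)^2},\quad \dot z_3=\frac{xy}{(x^2+y^2)^2},\qquad -va\le u(t)\le va,$$ and $s(0)=(x_0,y_0,\theta_0,0,0,0)$. For $\lambda=(\lambda_x,\lambda_y,\lambda_\theta,\lambda_{z_1},\lambda_{z_2},\lambda_{z_3})\in\mathbb R^6$ let $$H(s,u,\lambda):=\lambda_x v\cos\theta+\lambda_y v\sin\theta+\lambda_\theta\frac uv+\lambda_{z_1}\frac{x^2}{(x^2+y^2)^2}+\lambda_{z_2}\frac{y^2}{(x^2+y^2)^2}+\lambda_{z_3}\frac{xy}{(x^2+y^2)^2}.$$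 Suppose that $(s,u)$ is optimal for (P3). Then there exists an adjoint function $\lambda\in W^{1,2}([0,t_f];\mathbb R^6)$, that is, a solution of $$\dot\lambda(t)=-\frac{\partial H}{\partial s}(s(t),u(t),\lambda(t))\ \text{ for a.e. } t\in[0,t_f],\qquad \lambda(t_f)=\frac{\partial\varphi}{\partial s}(s(t_f)).$$ Moreover every such $\lambda$ satisfies $\lambda(t)\ne 0$ for all $t\in[0,t_f]$, and for a.e. $t\in[0,t_f]$ the value $u(t)$ minimizes $w\mapsto H(s(t),w,\lambda(t))$ over $[-va,va]$ and $$u(t)=\begin{cases} va, & \text{if } \lambda_\theta(t)<0,\\ -va, & \text{if } \lambda_\theta(t)>0,\\ \text{undetermined}, & \text{if } \lambda_\theta(t)=0,\end{cases}$$ where "undetermined" means that every $w\in[-va,va]$ minimizes $H(s(t),\cdot,\lambda(t))$ over $[-va,va]$, so that the minimum condition does not restrict $u(t)$. -/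

import Mathlib

open MeasureTheory Set

noncomputable section

namespace Bearings

/-- `W^{1,2}([0,T]; ℝ⁶)`, through the continuous representative: every component is absolutely
continuous on `[0,T]` with a square integrable derivative. -/
def IsW12 (T : ℝ) (f : ℝ → Fin 6 → ℝ) : Prop :=
  ∀ i, AbsolutelyContinuousOnInterval (fun t => f t i) 0 T ∧
    MemLp (deriv fun t => f t i) 2 (volume.restrict (Icc 0 T))

/-- Right-hand side of the dynamics. The state is `s = (x, y, θ, z₁, z₂, z₃)`, the control is `u`.
At `x = y = 0` the last three components take a default value; this is immaterial: a path of
speed `v > 0` through the origin makes `1 / (x² + y²)`, the derivative of `z₁ + z₂`, non-integrable,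
so no admissible path (see `IsAdmissible`) meets the origin. -/
def dynamics (v : ℝ) (s : Fin 6 → ℝ) (u : ℝ) : Fin 6 → ℝ :=
  ![v * Real.cos (s 2),
    v * Real.sin (s 2),
    u / v,
    s 0 ^ 2 / (s 0 ^ 2 + s 1 ^ 2) ^ 2,
    s 1 ^ 2 / (s 0 ^ 2 + s 1 ^ 2) ^ 2,
    s 0 * s 1 / (s 0 ^ 2 + s 1 ^ 2) ^ 2]

/-- Admissible state-control pairs of the optimal control problem: `s ∈ W^{1,2}`, `u ∈ L^∞`,
the differential equations and the control bound hold almost everywhere on `[0,T]`, and the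
state starts at `(x₀, y₀, θ₀, 0, 0, 0)`. -/
structure IsAdmissible (v a T x₀ y₀ θ₀ : ℝ) (s : ℝ → Fin 6 → ℝ) (u : ℝ → ℝ) : Prop where
  state_mem : IsW12 T s
  control_mem : MemLp u ⊤ (volume.restrict (Icc 0 T))
  ode : ∀ᵐ t ∂volume.restrict (Icc 0 T),
    ∀ i, HasDerivAt (fun τ => s τ i) (dynamics v (s t) (u t) i) t
  init : s 0 = ![x₀, y₀, θ₀, 0, 0, 0]
  bound : ∀ᵐ t ∂volume.restrict (Icc 0 T), -(v * a) ≤ u t ∧ u t ≤ v * a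

/-- Terminal cost `φ(s) = z₃² - z₁ z₂`. -/
def terminalCost (s : Fin 6 → ℝ) : ℝ := s 5 ^ 2 - s 3 * s 4

/-- Optimal pairs: admissible, with the least terminal cost among all admissible pairs. -/
def IsOptimal (v a T x₀ y₀ θ₀ : ℝ) (s : ℝ → Fin 6 → ℝ) (u : ℝ → ℝ) : Prop :=
  IsAdmissible v a T x₀ y₀ θ₀ s u ∧
    ∀ s' u', IsAdmissible v a T x₀ y₀ θ₀ s' u' → terminalCost (s T) ≤ terminalCost (s' T)

/-- The Hamiltonian `H(s, u, l)`, with `l = (l_x, l_y, l_θ, l_{z₁}, l_{z₂}, l_{z₃})`. -/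
def hamiltonian (v : ℝ) (s : Fin 6 → ℝ) (u : ℝ) (l : Fin 6 → ℝ) : ℝ :=
  l 0 * v * Real.cos (s 2) + l 1 * v * Real.sin (s 2) + l 2 * (u / v)
    + l 3 * (s 0 ^ 2 / (s 0 ^ 2 + s 1 ^ 2) ^ 2)
    + l 4 * (s 1 ^ 2 / (s 0 ^ 2 + s 1 ^ 2) ^ 2)
    + l 5 * (s 0 * s 1 / (s 0 ^ 2 + s 1 ^ 2) ^ 2)

/-- The partial derivative of `f` at `s` with respect to the `i`-th coordinate. -/
def partialDeriv (f : (Fin 6 → ℝ) → ℝ) (i : Fin 6) (s : Fin 6 → ℝ) : ℝ :=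
  deriv (fun ξ => f (Function.update s i ξ)) (s i)

/-- `l` is an adjoint (costate) function along `(s, u)`: `l ∈ W^{1,2}`, `l' = -H_s` almost
everywhere on `[0,T]`, and `l(T) = φ_s(s(T))`. -/
structure IsAdjoint (v T : ℝ) (s : ℝ → Fin 6 → ℝ) (u : ℝ → ℝ) (l : ℝ → Fin 6 → ℝ) : Prop where
  mem : IsW12 T l
  ode : ∀ᵐ t ∂volume.restrict (Icc 0 T),
    ∀ i, HasDerivAt (fun τ => l τ i)
      (-partialDeriv (fun σ => hamiltonian v σ (u t) (l t)) i (s t)) t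
  terminal : ∀ i, l T i = partialDeriv terminalCost i (s T)

/-- `w` minimizes the Hamiltonian `H(s, ·, l)` over the control set `[-va, va]`. -/
def MinimizesHamiltonian (v a : ℝ) (s l : Fin 6 → ℝ) (w : ℝ) : Prop :=
  w ∈ Icc (-(v * a)) (v * a) ∧
    ∀ w' ∈ Icc (-(v * a)) (v * a), hamiltonian v s w l ≤ hamiltonian v s w' l

end Bearings

end

/-! The control enters only through `θ' = u / v`. Hence moving `u` to `u + e (w - u)` turns the
heading into `θ + e D` with `D = ∫ (w - u) / v`, and `x, y, z₁, z₂, z₃` become explicit integrals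
depending on `e`. They can be differentiated under the integral sign once the rates are smooth near
the path. That holds because an admissible path avoids the origin: otherwise `z₁ + z₂ = ∫ 1 / (x² +
y²)` would diverge (`ne_zero_of_integrable_inv`).

Optimality makes the first variation of the cost nonnegative for every measurable `w` with values in
the control set (`IsOptimal.first_variation_nonneg`). Pairing the costate with the linearized state
and integrating by parts shows that this variation equals `∫ λ_θ (w - u) / v`
(`IsAdjoint.first_variation_eq`). With `w` the bang-bang control for `λ_θ` the integrand is also
nonpositive, so it vanishes almost everywhere. This one choice gives the whole minimum condition,
since `H` is affine in the control.

The adjoint system is triangular, so it is solved by successive integrations. A costate cannot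
vanish: `λ_{z₁} + λ_{z₂}` is constantly `-(z₁ + z₂)(T) < 0`. -/

namespace Bearings

open Filter Topology

/-! ### Absolutely continuous functions on an interval -/

theorem ae_mem_Icc_of_ae_restrict {T : ℝ} {p : ℝ → Prop}
    (h : ∀ᵐ t ∂volume.restrict (Icc 0 T), p t) : ∀ᵐ t, t ∈ Icc 0 T → p t :=
  (ae_restrict_iff' measurableSet_Icc).1 h

/-- The integrability of `g` matters as much as the formula: applied to `z₁` and `z₂`, it is what
keeps paths away from the origin. -/
theorem integral_eq_of_ae_hasDerivAt {T : ℝ} (hT : 0 ≤ T) {f g : ℝ → ℝ}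
    (hf : AbsolutelyContinuousOnInterval f 0 T)
    (hd : ∀ᵐ t ∂volume.restrict (Icc 0 T), HasDerivAt f (g t) t) {t : ℝ} (ht : t ∈ Icc 0 T) :
    IntervalIntegrable g volume 0 t ∧ ∫ τ in (0 : ℝ)..t, g τ = f t - f 0 := by
  have hf' : AbsolutelyContinuousOnInterval f 0 t := by
    apply hf.mono
    rw [uIcc_of_le ht.1, uIcc_of_le hT]
    exact Icc_subset_Icc_right ht.2
  have hae : ∀ᵐ τ, τ ∈ uIoc 0 t → deriv f τ = g τ := by
    filter_upwards [ae_mem_Icc_of_ae_restrict hd] with τ h hτ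
    rw [uIoc_of_le ht.1] at hτ
    exact (h ⟨hτ.1.le, hτ.2.trans ht.2⟩).deriv
  refine ⟨hf'.intervalIntegrable_deriv.congr_ae ?_, ?_⟩
  · exact (ae_restrict_iff' measurableSet_uIoc).2 hae
  · rw [← hf'.integral_deriv_eq_sub]
    exact intervalIntegral.integral_congr_ae (by
      filter_upwards [hae] with τ h hτ using (h hτ).symm)

theorem memLp_deriv_of_bound {T C : ℝ} {f g : ℝ → ℝ}
    (hd : ∀ᵐ t ∂volume.restrict (Icc 0 T), HasDerivAt f (g t) t)
    (hC : ∀ᵐ t ∂volume.restrict (Icc 0 T), |g t| ≤ C) :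
    MemLp (deriv f) 2 (volume.restrict (Icc 0 T)) := by
  refine MemLp.of_bound (measurable_deriv f).aestronglyMeasurable C ?_
  filter_upwards [hd, hC] with t h1 h2
  rw [h1.deriv]
  exact h2

theorem w12_of_continuous_deriv {T : ℝ} {f g : ℝ → ℝ}
    (hd : ∀ t, HasDerivAt f (g t) t) (hg : Continuous g) :
    AbsolutelyContinuousOnInterval f 0 T ∧ MemLp (deriv f) 2 (volume.restrict (Icc 0 T)) := by
  have hderiv : deriv f = g := funext fun t => (hd t).deriv
  have hf : ContDiff ℝ 1 f :=
    contDiff_one_iff_deriv.2 ⟨fun t => (hd t).differentiableAt, hderiv ▸ hg⟩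
  obtain ⟨C, hC⟩ := (isCompact_Icc (a := 0) (b := T)).exists_bound_of_continuousOn hg.continuousOn
  refine ⟨hf.contDiffOn.absolutelyContinuousOnInterval,
    memLp_deriv_of_bound (C := C) (.of_forall hd) ?_⟩
  exact (ae_restrict_iff' measurableSet_Icc).2 (.of_forall hC)

theorem hasDerivAt_integral_of_continuous {g : ℝ → ℝ} (hg : Continuous g) (a t : ℝ) :
    HasDerivAt (fun t => ∫ τ in a..t, g τ) (g t) t :=
  intervalIntegral.integral_hasDerivAt_right (hg.intervalIntegrable _ _)
    hg.stronglyMeasurable.stronglyMeasurableAtFilter hg.continuousAt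

/-! ### Clamping the time to the horizon -/

/-- The point of `[0,T]` closest to `t`. -/
noncomputable def clamp (T t : ℝ) : ℝ := max 0 (min t T)

theorem continuous_clamp (T : ℝ) : Continuous (clamp T) := by
  unfold clamp; fun_prop

theorem clamp_mem {T : ℝ} (hT : 0 ≤ T) (t : ℝ) : clamp T t ∈ Icc 0 T :=
  ⟨le_max_left _ _, max_le hT (min_le_right _ _)⟩

theorem clamp_of_mem {T t : ℝ} (ht : t ∈ Icc 0 T) : clamp T t = t := by
  rw [clamp, min_eq_left ht.2, max_eq_right ht.1]

/-- With integrands continuous on all of `ℝ`, their primitives have two-sided derivatives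
everywhere, endpoints included. -/
theorem continuous_comp_clamp {T : ℝ} (hT : 0 ≤ T) {f : ℝ → ℝ} (hf : ContinuousOn f (Icc 0 T)) :
    Continuous fun t => f (clamp T t) :=
  hf.comp_continuous (continuous_clamp T) (clamp_mem hT)

/-! ### Integrals depending on a parameter -/

/-- Compactness of the closed ball times the time interval supplies a constant dominating bound.
Only a ball of parameters is allowed, because a large perturbation may meet the origin. -/
theorem hasDerivAt_integral_param {f f' : ℝ → ℝ → ℝ} {e₀ δ : ℝ} (hδ : 0 < δ) (a b : ℝ)
    (hf : ContinuousOn (Function.uncurry f) (Metric.closedBall e₀ δ ×ˢ univ))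
    (hf' : ContinuousOn (Function.uncurry f') (Metric.closedBall e₀ δ ×ˢ univ))
    (hd : ∀ e ∈ Metric.closedBall e₀ δ, ∀ t, HasDerivAt (fun e => f e t) (f' e t) e) :
    HasDerivAt (fun e => ∫ t in a..b, f e t) (∫ t in a..b, f' e₀ t) e₀ := by
  have hslice : ∀ {g : ℝ → ℝ → ℝ},
      ContinuousOn (Function.uncurry g) (Metric.closedBall e₀ δ ×ˢ univ) →
      ∀ e ∈ Metric.closedBall e₀ δ, Continuous (g e) := fun {g} hg e he =>
    hg.comp_continuous (f := fun t : ℝ => (e, t)) (by fun_prop) fun t => ⟨he, mem_univ t⟩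
  have hmem : Metric.closedBall e₀ δ ∈ 𝓝 e₀ := Metric.closedBall_mem_nhds e₀ hδ
  have h0 : e₀ ∈ Metric.closedBall e₀ δ := Metric.mem_closedBall_self hδ.le
  obtain ⟨C, hC⟩ := ((isCompact_closedBall e₀ δ).prod
    (isCompact_uIcc (a := a) (b := b))).exists_bound_of_continuousOn
      (hf'.mono (prod_mono_right (subset_univ _)))
  refine (intervalIntegral.hasDerivAt_integral_of_dominated_loc_of_deriv_le
    (F := f) (F' := f') (bound := fun _ => C) hmem ?_ ((hslice hf e₀ h0).intervalIntegrable _ _)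
    (hslice hf' e₀ h0).aestronglyMeasurable ?_ (by simp) ?_).2
  · filter_upwards [hmem] with e he using (hslice hf e he).aestronglyMeasurable
  · exact .of_forall fun t ht e he => hC (e, t) ⟨he, uIoc_subset_uIcc ht⟩
  · exact .of_forall fun t _ e he => hd e he t

/-- One-sided, since `u + e (w - u)` is guaranteed to respect the control bound only for `e ∈
[0,1]`. -/
theorem nonneg_of_hasDerivAt_of_le {F : ℝ → ℝ} {d δ : ℝ} (hF : HasDerivAt F d 0) (hδ : 0 < δ)
    (hmin : ∀ e ∈ Ioo 0 δ, F 0 ≤ F e) : 0 ≤ d := by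
  have h := hF.hasDerivWithinAt (s := Ioi 0)
  rw [hasDerivWithinAt_iff_tendsto_slope' (by simp)] at h
  refine ge_of_tendsto h ?_
  filter_upwards [Ioo_mem_nhdsGT hδ] with e he
  rw [slope_def_field]
  exact div_nonneg (sub_nonneg.2 (hmin e he)) (by linarith [he.1])

/-! ### The information rates -/

/-- `(p x² + q y² + r x y) / (x² + y²)²`, the combination of the rates of `z₁, z₂, z₃` with
weights `p, q, r`. -/
noncomputable def rate (p q r x y : ℝ) : ℝ :=
  (p * x ^ 2 + q * y ^ 2 + r * (x * y)) / (x ^ 2 + y ^ 2) ^ 2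

/-- The derivative of `rate` in `x`. -/
noncomputable def rateX (p q r x y : ℝ) : ℝ :=
  ((2 * p * x + r * y) * (x ^ 2 + y ^ 2) - 4 * x * (p * x ^ 2 + q * y ^ 2 + r * (x * y))) /
    (x ^ 2 + y ^ 2) ^ 3

/-- The derivative of `rate` in `y`. -/
noncomputable def rateY (p q r x y : ℝ) : ℝ :=
  ((2 * q * y + r * x) * (x ^ 2 + y ^ 2) - 4 * y * (p * x ^ 2 + q * y ^ 2 + r * (x * y))) /
    (x ^ 2 + y ^ 2) ^ 3

theorem hasDerivAt_rate {x y : ℝ → ℝ} {x' y' e : ℝ} (p q r : ℝ) (hx : HasDerivAt x x' e)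
    (hy : HasDerivAt y y' e) (h : x e ^ 2 + y e ^ 2 ≠ 0) :
    HasDerivAt (fun e => rate p q r (x e) (y e))
      (rateX p q r (x e) (y e) * x' + rateY p q r (x e) (y e) * y') e := by
  have hn := (((hx.fun_pow 2).const_mul p).fun_add ((hy.fun_pow 2).const_mul q)).fun_add
    ((hx.fun_mul hy).const_mul r)
  have hden := ((hx.fun_pow 2).fun_add (hy.fun_pow 2)).fun_pow 2
  refine (hn.fun_div hden (pow_ne_zero 2 h)).congr_deriv ?_
  unfold rateX rateY
  field_simp
  ring

theorem rateX_linear (p q r x y : ℝ) : rateX p q r x y =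
    p * rateX 1 0 0 x y + q * rateX 0 1 0 x y + r * rateX 0 0 1 x y := by
  unfold rateX; ring

theorem rateY_linear (p q r x y : ℝ) : rateY p q r x y =
    p * rateY 1 0 0 x y + q * rateY 0 1 0 x y + r * rateY 0 0 1 x y := by
  unfold rateY; ring

section

variable {α : Type*} [TopologicalSpace α] {x y : α → ℝ} {A : Set α}

theorem continuousOn_rate (p q r : ℝ) (hx : ContinuousOn x A) (hy : ContinuousOn y A)
    (h : ∀ a ∈ A, x a ^ 2 + y a ^ 2 ≠ 0) : ContinuousOn (fun a => rate p q r (x a) (y a)) A :=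
  ContinuousOn.div (by fun_prop) (by fun_prop) fun a ha => pow_ne_zero 2 (h a ha)

theorem continuousOn_rateX (p q r : ℝ) (hx : ContinuousOn x A) (hy : ContinuousOn y A)
    (h : ∀ a ∈ A, x a ^ 2 + y a ^ 2 ≠ 0) : ContinuousOn (fun a => rateX p q r (x a) (y a)) A :=
  ContinuousOn.div (by fun_prop) (by fun_prop) fun a ha => pow_ne_zero 3 (h a ha)

theorem continuousOn_rateY (p q r : ℝ) (hx : ContinuousOn x A) (hy : ContinuousOn y A)
    (h : ∀ a ∈ A, x a ^ 2 + y a ^ 2 ≠ 0) : ContinuousOn (fun a => rateY p q r (x a) (y a)) A :=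
  ContinuousOn.div (by fun_prop) (by fun_prop) fun a ha => pow_ne_zero 3 (h a ha)

end

/-! ### Partial derivatives -/

theorem hamiltonian_eq (v : ℝ) (s : Fin 6 → ℝ) (u : ℝ) (l : Fin 6 → ℝ) :
    hamiltonian v s u l = l 0 * v * Real.cos (s 2) + l 1 * v * Real.sin (s 2) + l 2 * (u / v) +
      rate (l 3) (l 4) (l 5) (s 0) (s 1) := by
  unfold hamiltonian rate; ring

theorem partialDeriv_hamiltonian (v : ℝ) (s : Fin 6 → ℝ) (u : ℝ) (l : Fin 6 → ℝ)
    (h : s 0 ^ 2 + s 1 ^ 2 ≠ 0) (i : Fin 6) :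
    partialDeriv (fun σ => hamiltonian v σ u l) i s =
      ![rateX (l 3) (l 4) (l 5) (s 0) (s 1), rateY (l 3) (l 4) (l 5) (s 0) (s 1),
        -(l 0 * v * Real.sin (s 2)) + l 1 * v * Real.cos (s 2), 0, 0, 0] i := by
  unfold partialDeriv
  simp only [hamiltonian_eq]
  apply HasDerivAt.deriv
  fin_cases i <;> simp [Function.update]
  · simpa using (hasDerivAt_rate (l 3) (l 4) (l 5) (hasDerivAt_id (s 0))
      (hasDerivAt_const (s 0) (s 1)) h).const_add
        (l 0 * v * Real.cos (s 2) + l 1 * v * Real.sin (s 2) + l 2 * (u / v))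
  · simpa using (hasDerivAt_rate (l 3) (l 4) (l 5) (hasDerivAt_const (s 1) (s 0))
      (hasDerivAt_id (s 1)) h).const_add
        (l 0 * v * Real.cos (s 2) + l 1 * v * Real.sin (s 2) + l 2 * (u / v))
  · simpa using ((((Real.hasDerivAt_cos (s 2)).const_mul (l 0 * v)).fun_add
      ((Real.hasDerivAt_sin (s 2)).const_mul (l 1 * v))).add_const (l 2 * (u / v))).add_const
        (rate (l 3) (l 4) (l 5) (s 0) (s 1))
  all_goals exact hasDerivAt_const _ _

theorem partialDeriv_terminalCost (s : Fin 6 → ℝ) (i : Fin 6) :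
    partialDeriv terminalCost i s = ![0, 0, 0, -s 4, -s 3, 2 * s 5] i := by
  unfold partialDeriv terminalCost
  apply HasDerivAt.deriv
  fin_cases i <;> simp [Function.update]
  · exact hasDerivAt_const _ _
  · exact hasDerivAt_const _ _
  · exact hasDerivAt_const _ _
  · simpa using ((hasDerivAt_id (s 3)).mul_const (s 4)).const_sub (s 5 ^ 2)
  · simpa using ((hasDerivAt_id (s 4)).const_mul (s 3)).const_sub (s 5 ^ 2)
  · simpa using ((hasDerivAt_id (s 5)).fun_pow 2).sub_const (s 3 * s 4)

/-! ### Planar paths with a perturbed heading -/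

/-- The abscissa at time `t` of the path from `x₀` with heading `h + e * d`. -/
noncomputable def pathX (v x₀ : ℝ) (h d : ℝ → ℝ) (e t : ℝ) : ℝ :=
  x₀ + ∫ τ in (0 : ℝ)..t, v * Real.cos (h τ + e * d τ)

/-- The ordinate at time `t` of the path from `y₀` with heading `h + e * d`. -/
noncomputable def pathY (v y₀ : ℝ) (h d : ℝ → ℝ) (e t : ℝ) : ℝ :=
  y₀ + ∫ τ in (0 : ℝ)..t, v * Real.sin (h τ + e * d τ)

/-- The derivative of `pathX` in the perturbation parameter. -/
noncomputable def varX (v : ℝ) (h d : ℝ → ℝ) (e t : ℝ) : ℝ :=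
  ∫ τ in (0 : ℝ)..t, -(v * Real.sin (h τ + e * d τ) * d τ)

/-- The derivative of `pathY` in the perturbation parameter. -/
noncomputable def varY (v : ℝ) (h d : ℝ → ℝ) (e t : ℝ) : ℝ :=
  ∫ τ in (0 : ℝ)..t, v * Real.cos (h τ + e * d τ) * d τ

section Paths

variable {v x₀ : ℝ} {h d : ℝ → ℝ}

theorem continuous_integral_param {f : ℝ → ℝ → ℝ} (hf : Continuous (Function.uncurry f)) :
    Continuous (Function.uncurry fun e t => ∫ τ in (0 : ℝ)..t, f e τ) :=
  intervalIntegral.continuous_parametric_intervalIntegral_of_continuous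
    (f := fun (z : ℝ × ℝ) τ => f z.1 τ)
    (hf.comp (f := fun z : (ℝ × ℝ) × ℝ => (z.1.1, z.2)) (by fun_prop)) continuous_snd

theorem continuous_pathX (hh : Continuous h) (hd : Continuous d) :
    Continuous (Function.uncurry (pathX v x₀ h d)) :=
  continuous_const.add (continuous_integral_param
    (f := fun e τ => v * Real.cos (h τ + e * d τ)) (by fun_prop))

theorem continuous_pathY (hh : Continuous h) (hd : Continuous d) :
    Continuous (Function.uncurry (pathY v x₀ h d)) :=
  continuous_const.add (continuous_integral_param
    (f := fun e τ => v * Real.sin (h τ + e * d τ)) (by fun_prop))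

theorem continuous_varX (hh : Continuous h) (hd : Continuous d) :
    Continuous (Function.uncurry (varX v h d)) :=
  continuous_integral_param (by fun_prop)

theorem continuous_varY (hh : Continuous h) (hd : Continuous d) :
    Continuous (Function.uncurry (varY v h d)) :=
  continuous_integral_param (by fun_prop)

theorem hasDerivAt_pathX_time (hh : Continuous h) (hd : Continuous d) (e t : ℝ) :
    HasDerivAt (pathX v x₀ h d e) (v * Real.cos (h t + e * d t)) t :=
  (hasDerivAt_integral_of_continuous (by fun_prop) 0 t).const_add x₀

theorem hasDerivAt_pathY_time (hh : Continuous h) (hd : Continuous d) (e t : ℝ) :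
    HasDerivAt (pathY v x₀ h d e) (v * Real.sin (h t + e * d t)) t :=
  (hasDerivAt_integral_of_continuous (by fun_prop) 0 t).const_add x₀

theorem hasDerivAt_varX_time (hh : Continuous h) (hd : Continuous d) (e t : ℝ) :
    HasDerivAt (varX v h d e) (-(v * Real.sin (h t + e * d t) * d t)) t :=
  hasDerivAt_integral_of_continuous (by fun_prop) 0 t

theorem hasDerivAt_varY_time (hh : Continuous h) (hd : Continuous d) (e t : ℝ) :
    HasDerivAt (varY v h d e) (v * Real.cos (h t + e * d t) * d t) t :=
  hasDerivAt_integral_of_continuous (by fun_prop) 0 t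

theorem hasDerivAt_pathX_param (hh : Continuous h) (hd : Continuous d) (e t : ℝ) :
    HasDerivAt (fun e => pathX v x₀ h d e t) (varX v h d e t) e := by
  refine (hasDerivAt_integral_param (f := fun e τ => v * Real.cos (h τ + e * d τ))
    (f' := fun e τ => -(v * Real.sin (h τ + e * d τ) * d τ)) one_pos 0 t
    (Continuous.continuousOn (by fun_prop)) (Continuous.continuousOn (by fun_prop))
    fun e _ τ => ?_).const_add x₀
  refine ((((hasDerivAt_id e).mul_const (d τ)).const_add (h τ)).cos.const_mul v).congr_deriv ?_
  simp; ring

theorem hasDerivAt_pathY_param (hh : Continuous h) (hd : Continuous d) (e t : ℝ) :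
    HasDerivAt (fun e => pathY v x₀ h d e t) (varY v h d e t) e := by
  refine (hasDerivAt_integral_param (f := fun e τ => v * Real.sin (h τ + e * d τ))
    (f' := fun e τ => v * Real.cos (h τ + e * d τ) * d τ) one_pos 0 t
    (Continuous.continuousOn (by fun_prop)) (Continuous.continuousOn (by fun_prop))
    fun e _ τ => ?_).const_add x₀
  refine ((((hasDerivAt_id e).mul_const (d τ)).const_add (h τ)).sin.const_mul v).congr_deriv ?_
  simp; ring

end Paths

/-- A path of nonzero speed along which `1 / (x² + y²)` is integrable avoids the origin. -/
theorem ne_zero_of_integrable_inv {v T : ℝ} (hv : v ≠ 0) (hT : 0 < T) {x y h : ℝ → ℝ}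
    (hx : ∀ t, HasDerivAt x (v * Real.cos (h t)) t)
    (hy : ∀ t, HasDerivAt y (v * Real.sin (h t)) t)
    (hint : IntervalIntegrable (fun t => (x t ^ 2 + y t ^ 2)⁻¹) volume 0 T)
    {t : ℝ} (ht : t ∈ Icc 0 T) : x t ^ 2 + y t ^ 2 ≠ 0 := by
  intro h0
  have hx0 : x t = 0 := by nlinarith [sq_nonneg (x t), sq_nonneg (y t)]
  have hy0 : y t = 0 := by nlinarith [sq_nonneg (x t), sq_nonneg (y t)]
  -- At a zero of `x² + y²`, its inverse dominates the non-integrable `1 / (τ - t)`; the first-order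
  -- bound `x² + y² = O(τ - t)` suffices.
  refine not_intervalIntegrable_of_sub_inv_isBigO_punctured (c := t) ?_ hT.ne
    (by rwa [uIcc_of_le hT.le]) hint
  have key : ∀ {f : ℝ → ℝ} {f' : ℝ}, HasDerivAt f f' t → f t = 0 →
      (fun τ => f τ ^ 2) =O[𝓝 t] fun τ => τ - t := by
    intro f f' hf hf0
    have h1 : f =O[𝓝 t] fun τ => τ - t := by simpa [hf0] using hf.isBigO_sub
    have h2 : f =O[𝓝 t] fun _ => (1 : ℝ) := hf.continuousAt.isBigO_one ℝ
    simpa [sq] using h1.mul h2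
  refine (((key (hx t) hx0).add (key (hy t) hy0)).mono nhdsWithin_le_nhds).inv_rev ?_
  -- Inverting the estimate requires an isolated zero, which holds because the velocity is nonzero
  -- at `t`.
  have hne : ∀ᶠ τ in 𝓝[≠] t, x τ ≠ 0 ∨ y τ ≠ 0 := by
    by_cases hc : Real.cos (h t) = 0
    · have hs : Real.sin (h t) ≠ 0 := by
        intro hs
        simpa [hc, hs] using Real.sin_sq_add_cos_sq (h t)
      filter_upwards [(hy t).eventually_ne (c := 0) (mul_ne_zero hv hs)] with τ hτ using Or.inr hτ
    · filter_upwards [(hx t).eventually_ne (c := 0) (mul_ne_zero hv hc)] with τ hτ using Or.inl hτ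
  filter_upwards [hne] with τ hτ h0
  exfalso
  rcases hτ with hτ | hτ <;> have := sq_pos_of_ne_zero hτ <;>
    nlinarith [sq_nonneg (x τ), sq_nonneg (y τ)]

/-! ### Admissible pairs -/

section Admissible

variable {v a T x₀ y₀ θ₀ : ℝ} {s : ℝ → Fin 6 → ℝ} {u : ℝ → ℝ}

/-- The heading of a state, made constant outside of `[0,T]`. -/
noncomputable def heading (T : ℝ) (s : ℝ → Fin 6 → ℝ) (t : ℝ) : ℝ := s (clamp T t) 2

theorem IsW12.continuousOn (hT : 0 ≤ T) (hs : IsW12 T s) (i : Fin 6) :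
    ContinuousOn (fun t => s t i) (Icc 0 T) := by
  simpa [uIcc_of_le hT] using (hs i).1.continuousOn

theorem continuous_heading (hT : 0 ≤ T) (hs : IsW12 T s) : Continuous (heading T s) :=
  continuous_comp_clamp hT (hs.continuousOn hT 2)

namespace IsAdmissible

variable (hs : IsAdmissible v a T x₀ y₀ θ₀ s u)

include hs

theorem component_eq (hT : 0 ≤ T) (i : Fin 6) {t : ℝ} (ht : t ∈ Icc 0 T) :
    IntervalIntegrable (fun t => dynamics v (s t) (u t) i) volume 0 t ∧
      s t i = s 0 i + ∫ τ in (0 : ℝ)..t, dynamics v (s τ) (u τ) i := by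
  have h := integral_eq_of_ae_hasDerivAt hT (hs.state_mem i).1
    (hs.ode.mono fun t h => h i) ht
  exact ⟨h.1, by linarith [h.2]⟩

/-- The direction `d` is free because it is multiplied by `e = 0`; the path is thus the base point
of every variation. -/
theorem x_eq (hT : 0 ≤ T) (d : ℝ → ℝ) {t : ℝ} (ht : t ∈ Icc 0 T) :
    s t 0 = pathX v x₀ (heading T s) d 0 t := by
  rw [(hs.component_eq hT 0 ht).2, hs.init, pathX]
  congr 1
  refine intervalIntegral.integral_congr fun τ hτ => ?_
  rw [uIcc_of_le ht.1] at hτ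
  simp [dynamics, heading, clamp_of_mem ⟨hτ.1, hτ.2.trans ht.2⟩]

theorem y_eq (hT : 0 ≤ T) (d : ℝ → ℝ) {t : ℝ} (ht : t ∈ Icc 0 T) :
    s t 1 = pathY v y₀ (heading T s) d 0 t := by
  rw [(hs.component_eq hT 1 ht).2, hs.init, pathY]
  congr 1
  refine intervalIntegral.integral_congr fun τ hτ => ?_
  rw [uIcc_of_le ht.1] at hτ
  simp [dynamics, heading, clamp_of_mem ⟨hτ.1, hτ.2.trans ht.2⟩]

theorem inv_integrable (hT : 0 ≤ T) :
    IntervalIntegrable (fun t => (s t 0 ^ 2 + s t 1 ^ 2)⁻¹) volume 0 T ∧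
      ∫ t in (0 : ℝ)..T, (s t 0 ^ 2 + s t 1 ^ 2)⁻¹ = s T 3 + s T 4 := by
  have h3 := hs.component_eq hT 3 (right_mem_Icc.2 hT)
  have h4 := hs.component_eq hT 4 (right_mem_Icc.2 hT)
  have heq : (fun t => (s t 0 ^ 2 + s t 1 ^ 2)⁻¹) = fun t =>
      dynamics v (s t) (u t) 3 + dynamics v (s t) (u t) 4 := by
    funext t
    simp only [dynamics, Matrix.cons_val]
    rw [← add_div]
    -- At the origin both sides are `0` by the convention on division, so avoidance of the origin is
    -- not presupposed.
    rcases eq_or_ne (s t 0 ^ 2 + s t 1 ^ 2) 0 with h | h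
    · simp [h]
    · field_simp
  rw [heq]
  refine ⟨h3.1.add h4.1, ?_⟩
  rw [intervalIntegral.integral_add h3.1 h4.1]
  have e3 := h3.2
  have e4 := h4.2
  simp only [hs.init, Matrix.cons_val, zero_add] at e3 e4
  rw [e3, e4]

theorem ne_zero (hv : v ≠ 0) (hT : 0 < T) {t : ℝ} (ht : t ∈ Icc 0 T) :
    s t 0 ^ 2 + s t 1 ^ 2 ≠ 0 := by
  have hh := continuous_heading hT.le hs.state_mem
  rw [hs.x_eq hT.le (fun _ => 0) ht, hs.y_eq hT.le (fun _ => 0) ht]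
  refine ne_zero_of_integrable_inv (h := heading T s) hv hT
    (fun t => by simpa using hasDerivAt_pathX_time hh continuous_const 0 t)
    (fun t => by simpa using hasDerivAt_pathY_time hh continuous_const 0 t) ?_ ht
  refine (hs.inv_integrable hT.le).1.congr fun τ hτ => ?_
  rw [uIoc_of_le hT.le] at hτ
  simp only [hs.x_eq hT.le (fun _ => 0) ⟨hτ.1.le, hτ.2⟩, hs.y_eq hT.le (fun _ => 0) ⟨hτ.1.le, hτ.2⟩]

theorem z_sum_pos (hv : v ≠ 0) (hT : 0 < T) : 0 < s T 3 + s T 4 := by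
  rw [← (hs.inv_integrable hT.le).2]
  refine intervalIntegral.intervalIntegral_pos_of_pos_on (hs.inv_integrable hT.le).1
    (fun t ht => ?_) hT
  exact inv_pos.2 (lt_of_le_of_ne (by positivity) (hs.ne_zero hv hT ⟨ht.1.le, ht.2.le⟩).symm)

end IsAdmissible

end Admissible

/-! ### Perturbed admissible pairs -/

/-- The variation at time `t` of the heading when the control `u` is moved towards `w`. -/
noncomputable def headingVar (v : ℝ) (u w : ℝ → ℝ) (t : ℝ) : ℝ :=
  ∫ τ in (0 : ℝ)..t, (w τ - u τ) / v

/-- The rate of information along the path with heading `h + e * d`, stopped at time `T`. -/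
noncomputable def pathRate (v T x₀ y₀ : ℝ) (h d : ℝ → ℝ) (p q r e t : ℝ) : ℝ :=
  rate p q r (pathX v x₀ h d e (clamp T t)) (pathY v y₀ h d e (clamp T t))

/-- The derivative of `pathRate` in the perturbation parameter. -/
noncomputable def pathRateVar (v T x₀ y₀ : ℝ) (h d : ℝ → ℝ) (p q r e t : ℝ) : ℝ :=
  rateX p q r (pathX v x₀ h d e (clamp T t)) (pathY v y₀ h d e (clamp T t)) *
      varX v h d e (clamp T t) +
    rateY p q r (pathX v x₀ h d e (clamp T t)) (pathY v y₀ h d e (clamp T t)) *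
      varY v h d e (clamp T t)

/-- The state that the control `u + e * (w - u)` produces, with `d` the variation of the
heading. -/
noncomputable def perturbedState (v T x₀ y₀ : ℝ) (s : ℝ → Fin 6 → ℝ) (d : ℝ → ℝ) (e t : ℝ) :
    Fin 6 → ℝ :=
  ![pathX v x₀ (heading T s) (fun τ => d (clamp T τ)) e t,
    pathY v y₀ (heading T s) (fun τ => d (clamp T τ)) e t,
    s t 2 + e * d t,
    ∫ τ in (0 : ℝ)..t, pathRate v T x₀ y₀ (heading T s) (fun τ => d (clamp T τ)) 1 0 0 e τ,
    ∫ τ in (0 : ℝ)..t, pathRate v T x₀ y₀ (heading T s) (fun τ => d (clamp T τ)) 0 1 0 e τ,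
    ∫ τ in (0 : ℝ)..t, pathRate v T x₀ y₀ (heading T s) (fun τ => d (clamp T τ)) 0 0 1 e τ]

section PathRate

variable {v T x₀ y₀ : ℝ} {h d : ℝ → ℝ}

/-- Joint continuity in `(e, t)` and compactness of `[0,T]` give one `δ` for all times. -/
theorem exists_closedBall_path_ne_zero (hT : 0 ≤ T) (hh : Continuous h) (hd : Continuous d)
    (h0 : ∀ t ∈ Icc 0 T, pathX v x₀ h d 0 t ^ 2 + pathY v y₀ h d 0 t ^ 2 ≠ 0) :
    ∃ δ > 0, ∀ e ∈ Metric.closedBall (0 : ℝ) δ, ∀ t,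
      pathX v x₀ h d e (clamp T t) ^ 2 + pathY v y₀ h d e (clamp T t) ^ 2 ≠ 0 := by
  have hc : Continuous fun z : ℝ × ℝ =>
      pathX v x₀ h d z.1 z.2 ^ 2 + pathY v y₀ h d z.1 z.2 ^ 2 :=
    ((continuous_pathX (x₀ := x₀) hh hd).pow 2).add ((continuous_pathY (x₀ := y₀) hh hd).pow 2)
  have hev := (isCompact_Icc (a := 0) (b := T)).eventually_forall_of_forall_eventually
    (x₀ := (0 : ℝ)) (P := fun e t => pathX v x₀ h d e t ^ 2 + pathY v y₀ h d e t ^ 2 ≠ 0)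
    fun t ht => hc.continuousAt.eventually_ne (h0 t ht)
  obtain ⟨δ, hδ, hball⟩ := Metric.nhds_basis_closedBall.eventually_iff.1 hev
  exact ⟨δ, hδ, fun e he t => hball he _ (clamp_mem hT t)⟩

theorem continuousOn_pathRate (hh : Continuous h) (hd : Continuous d) (p q r : ℝ) {A : Set ℝ}
    (hA : ∀ e ∈ A, ∀ t,
      pathX v x₀ h d e (clamp T t) ^ 2 + pathY v y₀ h d e (clamp T t) ^ 2 ≠ 0) :
    ContinuousOn (Function.uncurry (pathRate v T x₀ y₀ h d p q r)) (A ×ˢ univ) := by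
  have hc : Continuous fun z : ℝ × ℝ => (z.1, clamp T z.2) := by
    have := continuous_clamp T
    fun_prop
  exact continuousOn_rate p q r ((continuous_pathX hh hd).comp hc).continuousOn
    ((continuous_pathY hh hd).comp hc).continuousOn fun z hz => hA z.1 hz.1 z.2

theorem continuousOn_pathRateVar (hh : Continuous h) (hd : Continuous d) (p q r : ℝ) {A : Set ℝ}
    (hA : ∀ e ∈ A, ∀ t,
      pathX v x₀ h d e (clamp T t) ^ 2 + pathY v y₀ h d e (clamp T t) ^ 2 ≠ 0) :
    ContinuousOn (Function.uncurry (pathRateVar v T x₀ y₀ h d p q r)) (A ×ˢ univ) := by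
  have hc : Continuous fun z : ℝ × ℝ => (z.1, clamp T z.2) := by
    have := continuous_clamp T
    fun_prop
  have hX := ((continuous_pathX (v := v) (x₀ := x₀) hh hd).comp hc).continuousOn (s := A ×ˢ univ)
  have hY := ((continuous_pathY (v := v) (x₀ := y₀) hh hd).comp hc).continuousOn (s := A ×ˢ univ)
  exact ((continuousOn_rateX p q r hX hY fun z hz => hA z.1 hz.1 z.2).mul
      ((continuous_varX hh hd).comp hc).continuousOn).add
    ((continuousOn_rateY p q r hX hY fun z hz => hA z.1 hz.1 z.2).mul
      ((continuous_varY hh hd).comp hc).continuousOn)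

theorem continuous_pathRate (hh : Continuous h) (hd : Continuous d) (p q r : ℝ) {e : ℝ}
    (he : ∀ t, pathX v x₀ h d e (clamp T t) ^ 2 + pathY v y₀ h d e (clamp T t) ^ 2 ≠ 0) :
    Continuous (pathRate v T x₀ y₀ h d p q r e) :=
  (continuousOn_pathRate hh hd p q r (A := {e}) (by simpa using he)).comp_continuous
    (f := fun t : ℝ => (e, t)) (by fun_prop) fun t => ⟨rfl, mem_univ t⟩

theorem continuous_pathRateVar (hh : Continuous h) (hd : Continuous d) (p q r : ℝ) {e : ℝ}
    (he : ∀ t, pathX v x₀ h d e (clamp T t) ^ 2 + pathY v y₀ h d e (clamp T t) ^ 2 ≠ 0) :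
    Continuous (pathRateVar v T x₀ y₀ h d p q r e) :=
  (continuousOn_pathRateVar hh hd p q r (A := {e}) (by simpa using he)).comp_continuous
    (f := fun t : ℝ => (e, t)) (by fun_prop) fun t => ⟨rfl, mem_univ t⟩

theorem hasDerivAt_integral_pathRate (hh : Continuous h) (hd : Continuous d) (p q r : ℝ) {δ : ℝ}
    (hδ : 0 < δ) (hne : ∀ e ∈ Metric.closedBall (0 : ℝ) δ, ∀ t,
      pathX v x₀ h d e (clamp T t) ^ 2 + pathY v y₀ h d e (clamp T t) ^ 2 ≠ 0) :
    HasDerivAt (fun e => ∫ t in (0 : ℝ)..T, pathRate v T x₀ y₀ h d p q r e t)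
      (∫ t in (0 : ℝ)..T, pathRateVar v T x₀ y₀ h d p q r 0 t) 0 :=
  hasDerivAt_integral_param hδ 0 T (continuousOn_pathRate hh hd p q r hne)
    (continuousOn_pathRateVar hh hd p q r hne) fun e he t =>
      hasDerivAt_rate p q r (hasDerivAt_pathX_param hh hd e _) (hasDerivAt_pathY_param hh hd e _)
        (hne e he t)

/-- Lets the chain rule for `z₃² - z₁ z₂` be collected into one integral, weighted by the gradient
of the cost. -/
theorem pathRateVar_linear (p q r e t : ℝ) : pathRateVar v T x₀ y₀ h d p q r e t =
    p * pathRateVar v T x₀ y₀ h d 1 0 0 e t + q * pathRateVar v T x₀ y₀ h d 0 1 0 e t +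
      r * pathRateVar v T x₀ y₀ h d 0 0 1 e t := by
  unfold pathRateVar
  rw [rateX_linear p, rateY_linear p]
  ring

end PathRate

namespace IsAdmissible

variable {v a T x₀ y₀ θ₀ : ℝ} {s : ℝ → Fin 6 → ℝ} {u w : ℝ → ℝ}
  (hs : IsAdmissible v a T x₀ y₀ θ₀ s u)

include hs

theorem headingVar_integrable (hT : 0 ≤ T) (hw : Measurable w)
    (hwb : ∀ t, w t ∈ Icc (-(v * a)) (v * a)) :
    IntervalIntegrable (fun t => (w t - u t) / v) volume 0 T := by
  rw [intervalIntegrable_iff_integrableOn_Icc_of_le hT]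
  have hu : Integrable u (volume.restrict (Icc 0 T)) := hs.control_mem.integrable le_top
  have hw' : Integrable w (volume.restrict (Icc 0 T)) := by
    refine Integrable.of_bound hw.aestronglyMeasurable (v * a) (.of_forall fun t => ?_)
    exact abs_le.2 (hwb t)
  exact (hw'.sub hu).div_const v

theorem headingVar_ac (hT : 0 ≤ T) (hw : Measurable w)
    (hwb : ∀ t, w t ∈ Icc (-(v * a)) (v * a)) :
    AbsolutelyContinuousOnInterval (headingVar v u w) 0 T :=
  (hs.headingVar_integrable hT hw hwb).absolutelyContinuousOnInterval_intervalIntegral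
    left_mem_uIcc

theorem continuous_headingVar (hT : 0 ≤ T) (hw : Measurable w)
    (hwb : ∀ t, w t ∈ Icc (-(v * a)) (v * a)) :
    Continuous fun t => headingVar v u w (clamp T t) :=
  continuous_comp_clamp hT (by
    simpa [uIcc_of_le hT] using (hs.headingVar_ac hT hw hwb).continuousOn)

theorem headingVar_ae_hasDerivAt (hT : 0 ≤ T) (hw : Measurable w)
    (hwb : ∀ t, w t ∈ Icc (-(v * a)) (v * a)) :
    ∀ᵐ t ∂volume.restrict (Icc 0 T), HasDerivAt (headingVar v u w) ((w t - u t) / v) t := by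
  refine (ae_restrict_iff' measurableSet_Icc).2 ?_
  filter_upwards [(hs.headingVar_integrable hT hw hwb).ae_hasDerivAt_integral] with t h ht
  exact h (by rwa [uIcc_of_le hT]) 0 left_mem_uIcc

theorem perturbedState_isAdmissible (hT : 0 ≤ T) (hv : 0 < v) (hw : Measurable w)
    (hwb : ∀ t, w t ∈ Icc (-(v * a)) (v * a)) {e : ℝ} (he : e ∈ Icc 0 1)
    (hne : ∀ t, pathX v x₀ (heading T s) (fun τ => headingVar v u w (clamp T τ)) e (clamp T t) ^ 2 +
      pathY v y₀ (heading T s) (fun τ => headingVar v u w (clamp T τ)) e (clamp T t) ^ 2 ≠ 0) :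
    IsAdmissible v a T x₀ y₀ θ₀ (perturbedState v T x₀ y₀ s (headingVar v u w) e)
      (fun t => u t + e * (w t - u t)) := by
  have hh := continuous_heading hT hs.state_mem
  have hd := hs.continuous_headingVar hT hw hwb
  have hbound : ∀ᵐ t ∂volume.restrict (Icc 0 T),
      -(v * a) ≤ u t + e * (w t - u t) ∧ u t + e * (w t - u t) ≤ v * a := by
    filter_upwards [hs.bound] with t ht
    constructor <;> nlinarith [ht.1, ht.2, (hwb t).1, (hwb t).2, he.1, he.2]
  have hz : ∀ p q r : ℝ, ∀ t, HasDerivAt (fun t => ∫ τ in (0 : ℝ)..t,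
      pathRate v T x₀ y₀ (heading T s) (fun τ => headingVar v u w (clamp T τ)) p q r e τ)
      (pathRate v T x₀ y₀ (heading T s) (fun τ => headingVar v u w (clamp T τ)) p q r e t) t :=
    fun p q r t => hasDerivAt_integral_of_continuous (continuous_pathRate hh hd p q r hne) 0 t
  have hθ : ∀ᵐ t ∂volume.restrict (Icc 0 T),
      HasDerivAt (fun t => s t 2 + e * headingVar v u w t) ((u t + e * (w t - u t)) / v) t := by
    filter_upwards [hs.ode, hs.headingVar_ae_hasDerivAt hT hw hwb] with t h1 h2
    refine ((h1 2).add (h2.const_mul e)).congr_deriv ?_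
    simp only [dynamics, Matrix.cons_val]
    ring
  refine ⟨fun i => ?_, ?_, ?_, ?_, hbound⟩
  · fin_cases i
    · exact w12_of_continuous_deriv (hasDerivAt_pathX_time hh hd e) (by fun_prop)
    · exact w12_of_continuous_deriv (hasDerivAt_pathY_time hh hd e) (by fun_prop)
    -- The heading need not be `C¹`; its derivative is the new control divided by `v`, hence bounded
    -- by `a`.
    · refine ⟨(hs.state_mem 2).1.fun_add ((hs.headingVar_ac hT hw hwb).const_mul e),
        memLp_deriv_of_bound (C := a) hθ ?_⟩
      filter_upwards [hbound] with t ht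
      rw [abs_le, le_div_iff₀ hv, div_le_iff₀ hv]
      constructor <;> linarith [ht.1, ht.2]
    · exact w12_of_continuous_deriv (hz 1 0 0) (continuous_pathRate hh hd 1 0 0 hne)
    · exact w12_of_continuous_deriv (hz 0 1 0) (continuous_pathRate hh hd 0 1 0 hne)
    · exact w12_of_continuous_deriv (hz 0 0 1) (continuous_pathRate hh hd 0 0 1 hne)
  · refine MemLp.of_bound ?_ (v * a) (hbound.mono fun t ht => abs_le.2 ht)
    have hu := hs.control_mem.aestronglyMeasurable
    exact hu.add ((hw.aestronglyMeasurable.sub hu).const_mul e)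
  · filter_upwards [hθ, ae_restrict_mem measurableSet_Icc] with t h2 ht i
    fin_cases i
    · refine (hasDerivAt_pathX_time hh hd e t).congr_deriv ?_
      simp [dynamics, perturbedState, heading, clamp_of_mem ht]
    · refine (hasDerivAt_pathY_time hh hd e t).congr_deriv ?_
      simp [dynamics, perturbedState, heading, clamp_of_mem ht]
    · exact h2
    · refine (hz 1 0 0 t).congr_deriv ?_
      simp [dynamics, perturbedState, pathRate, rate, clamp_of_mem ht]
    · refine (hz 0 1 0 t).congr_deriv ?_
      simp [dynamics, perturbedState, pathRate, rate, clamp_of_mem ht]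
    · refine (hz 0 0 1 t).congr_deriv ?_
      simp [dynamics, perturbedState, pathRate, rate, clamp_of_mem ht]
  · have h2 : s 0 2 = θ₀ := by simp [hs.init]
    funext i
    fin_cases i <;> simp [perturbedState, pathX, pathY, headingVar, h2]

/-- The information gathered along an admissible path, in terms of the path. -/
theorem z_eq (hT : 0 ≤ T) (d : ℝ → ℝ) :
    s T 3 = ∫ t in (0 : ℝ)..T, pathRate v T x₀ y₀ (heading T s) d 1 0 0 0 t ∧
    s T 4 = ∫ t in (0 : ℝ)..T, pathRate v T x₀ y₀ (heading T s) d 0 1 0 0 t ∧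
    s T 5 = ∫ t in (0 : ℝ)..T, pathRate v T x₀ y₀ (heading T s) d 0 0 1 0 t := by
  refine ⟨?_, ?_, ?_⟩
  · rw [(hs.component_eq hT 3 (right_mem_Icc.2 hT)).2, hs.init]
    simp only [Matrix.cons_val, zero_add]
    refine intervalIntegral.integral_congr fun t ht => ?_
    rw [uIcc_of_le hT] at ht
    simp [dynamics, pathRate, rate, clamp_of_mem ht, hs.x_eq hT d ht, hs.y_eq hT d ht]
  · rw [(hs.component_eq hT 4 (right_mem_Icc.2 hT)).2, hs.init]
    simp only [Matrix.cons_val, zero_add]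
    refine intervalIntegral.integral_congr fun t ht => ?_
    rw [uIcc_of_le hT] at ht
    simp [dynamics, pathRate, rate, clamp_of_mem ht, hs.x_eq hT d ht, hs.y_eq hT d ht]
  · rw [(hs.component_eq hT 5 (right_mem_Icc.2 hT)).2, hs.init]
    simp only [Matrix.cons_val, zero_add]
    refine intervalIntegral.integral_congr fun t ht => ?_
    rw [uIcc_of_le hT] at ht
    simp [dynamics, pathRate, rate, clamp_of_mem ht, hs.x_eq hT d ht, hs.y_eq hT d ht]

end IsAdmissible

/-- The first variation of the terminal cost at an optimal pair is nonnegative. -/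
theorem IsOptimal.first_variation_nonneg {v a T x₀ y₀ θ₀ : ℝ} {s : ℝ → Fin 6 → ℝ} {u w : ℝ → ℝ}
    (hopt : IsOptimal v a T x₀ y₀ θ₀ s u) (hT : 0 < T) (hv : 0 < v) (hw : Measurable w)
    (hwb : ∀ t, w t ∈ Icc (-(v * a)) (v * a)) :
    0 ≤ ∫ t in (0 : ℝ)..T, pathRateVar v T x₀ y₀ (heading T s)
      (fun τ => headingVar v u w (clamp T τ)) (-s T 4) (-s T 3) (2 * s T 5) 0 t := by
  have hs := hopt.1
  have hh := continuous_heading hT.le hs.state_mem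
  have hd := hs.continuous_headingVar hT.le hw hwb
  set d : ℝ → ℝ := fun τ => headingVar v u w (clamp T τ) with hd_def
  have h0 : ∀ t ∈ Icc 0 T, pathX v x₀ (heading T s) d 0 t ^ 2 +
      pathY v y₀ (heading T s) d 0 t ^ 2 ≠ 0 := fun t ht => by
    rw [← hs.x_eq hT.le d ht, ← hs.y_eq hT.le d ht]
    exact hs.ne_zero hv.ne' hT ht
  obtain ⟨δ, hδ, hne⟩ := exists_closedBall_path_ne_zero hT.le hh hd h0
  obtain ⟨z3, z4, z5⟩ := hs.z_eq hT.le d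
  have d3 := hasDerivAt_integral_pathRate hh hd 1 0 0 hδ hne
  have d4 := hasDerivAt_integral_pathRate hh hd 0 1 0 hδ hne
  have d5 := hasDerivAt_integral_pathRate hh hd 0 0 1 hδ hne
  have hF : HasDerivAt
      (fun e => terminalCost (perturbedState v T x₀ y₀ s (headingVar v u w) e T)) _ 0 :=
    (d5.fun_pow 2).fun_sub (d3.fun_mul d4)
  -- `e < δ` keeps the path off the origin, `e < 1` keeps the control within its bounds.
  refine (nonneg_of_hasDerivAt_of_le hF (lt_min hδ one_pos) fun e he => ?_).trans_eq ?_
  · have hcost : terminalCost (perturbedState v T x₀ y₀ s (headingVar v u w) 0 T) =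
        terminalCost (s T) := by
      simp [terminalCost, perturbedState, ← hd_def, ← z3, ← z4, ← z5]
    rw [hcost]
    refine hopt.2 _ _ (hs.perturbedState_isAdmissible hT.le hv hw hwb
      ⟨he.1.le, (he.2.trans_le (min_le_right _ _)).le⟩ (hne e ?_))
    rw [Metric.mem_closedBall, Real.dist_0_eq_abs, abs_of_pos he.1]
    exact (he.2.trans_le (min_le_left _ _)).le
  · have hi : ∀ p q r : ℝ, IntervalIntegrable
        (pathRateVar v T x₀ y₀ (heading T s) d p q r 0) volume 0 T := fun p q r =>
      (continuous_pathRateVar hh hd p q r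
        (hne 0 (Metric.mem_closedBall_self hδ.le))).intervalIntegrable _ _
    simp only [pathRateVar_linear (-s T 4)]
    rw [intervalIntegral.integral_add (((hi _ _ _).const_mul _).add ((hi _ _ _).const_mul _))
      ((hi _ _ _).const_mul _), intervalIntegral.integral_add ((hi _ _ _).const_mul _)
      ((hi _ _ _).const_mul _)]
    have h4 : perturbedState v T x₀ y₀ s (headingVar v u w) 0 T 4 = s T 4 := z4.symm
    simp only [intervalIntegral.integral_const_mul, ← z3, ← z5, h4]
    ring

/-! ### Adjoint functions -/

section Adjoint

variable {v a T x₀ y₀ θ₀ : ℝ} {s l : ℝ → Fin 6 → ℝ} {u w : ℝ → ℝ}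

/-- The `z`-costates are constants; they determine `λ_x'` and `λ_y'`, which in turn determine
`λ_θ'`. Integrating from `T` builds in the zero terminal values. -/
theorem IsAdmissible.exists_isAdjoint (hs : IsAdmissible v a T x₀ y₀ θ₀ s u) (hv : v ≠ 0)
    (hT : 0 < T) : ∃ l, IsAdjoint v T s u l := by
  have hx := continuous_comp_clamp hT.le (hs.state_mem.continuousOn hT.le 0)
  have hy := continuous_comp_clamp hT.le (hs.state_mem.continuousOn hT.le 1)
  have hθ := continuous_heading hT.le hs.state_mem
  have hne : ∀ t, s (clamp T t) 0 ^ 2 + s (clamp T t) 1 ^ 2 ≠ 0 := fun t =>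
    hs.ne_zero hv hT (clamp_mem hT.le t)
  set p := -s T 4
  set q := -s T 3
  set r := 2 * s T 5
  have cX : Continuous fun t => -rateX p q r (s (clamp T t) 0) (s (clamp T t) 1) :=
    (continuousOn_univ.1 (continuousOn_rateX p q r hx.continuousOn hy.continuousOn
      fun t _ => hne t)).neg
  have cY : Continuous fun t => -rateY p q r (s (clamp T t) 0) (s (clamp T t) 1) :=
    (continuousOn_univ.1 (continuousOn_rateY p q r hx.continuousOn hy.continuousOn
      fun t _ => hne t)).neg
  set lx : ℝ → ℝ := fun t => ∫ τ in T..t, -rateX p q r (s (clamp T τ) 0) (s (clamp T τ) 1)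
  set ly : ℝ → ℝ := fun t => ∫ τ in T..t, -rateY p q r (s (clamp T τ) 0) (s (clamp T τ) 1)
  have dX : ∀ t, HasDerivAt lx _ t := hasDerivAt_integral_of_continuous cX T
  have dY : ∀ t, HasDerivAt ly _ t := hasDerivAt_integral_of_continuous cY T
  have clx : Continuous lx := continuous_iff_continuousAt.2 fun t => (dX t).continuousAt
  have cly : Continuous ly := continuous_iff_continuousAt.2 fun t => (dY t).continuousAt
  have cθ : Continuous fun t => -(-(lx t * v * Real.sin (heading T s t)) +
      ly t * v * Real.cos (heading T s t)) := by fun_prop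
  set lθ : ℝ → ℝ := fun t => ∫ τ in T..t, -(-(lx τ * v * Real.sin (heading T s τ)) +
      ly τ * v * Real.cos (heading T s τ))
  have dθ : ∀ t, HasDerivAt lθ _ t := hasDerivAt_integral_of_continuous cθ T
  refine ⟨fun t => ![lx t, ly t, lθ t, p, q, r], fun i => ?_, ?_, fun i => ?_⟩
  · fin_cases i
    · exact w12_of_continuous_deriv dX cX
    · exact w12_of_continuous_deriv dY cY
    · exact w12_of_continuous_deriv dθ cθ
    all_goals exact w12_of_continuous_deriv (fun t => hasDerivAt_const t _) continuous_const
  · filter_upwards [ae_restrict_mem measurableSet_Icc] with t ht i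
    rw [partialDeriv_hamiltonian v (s t) (u t) _ (hs.ne_zero hv hT ht)]
    fin_cases i
    · exact (dX t).congr_deriv (by simp [clamp_of_mem ht])
    · exact (dY t).congr_deriv (by simp [clamp_of_mem ht])
    · exact (dθ t).congr_deriv (by simp [heading, clamp_of_mem ht])
    all_goals exact (hasDerivAt_const t _).congr_deriv (by simp)
  · rw [partialDeriv_terminalCost]
    fin_cases i <;> simp [lx, ly, lθ, p, q, r]

namespace IsAdjoint

variable (hl : IsAdjoint v T s u l)

include hl

theorem ae_hasDerivAt (hs : IsAdmissible v a T x₀ y₀ θ₀ s u) (hv : v ≠ 0) (hT : 0 < T) :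
    ∀ᵐ t ∂volume.restrict (Icc 0 T), ∀ i, HasDerivAt (fun τ => l τ i)
      (-![rateX (l t 3) (l t 4) (l t 5) (s t 0) (s t 1),
        rateY (l t 3) (l t 4) (l t 5) (s t 0) (s t 1),
        -(l t 0 * v * Real.sin (s t 2)) + l t 1 * v * Real.cos (s t 2), 0, 0, 0] i) t := by
  filter_upwards [hl.ode, ae_restrict_mem measurableSet_Icc] with t h ht i
  rw [← partialDeriv_hamiltonian v (s t) (u t) (l t) (hs.ne_zero hv hT ht)]
  exact h i

theorem eq_terminal_of_zero (hT : 0 ≤ T) {i : Fin 6}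
    (h : ∀ᵐ t ∂volume.restrict (Icc 0 T), HasDerivAt (fun τ => l τ i) 0 t) {t : ℝ}
    (ht : t ∈ Icc 0 T) : l t i = ![0, 0, 0, -s T 4, -s T 3, 2 * s T 5] i := by
  rw [← partialDeriv_terminalCost, ← hl.terminal]
  have h1 := (integral_eq_of_ae_hasDerivAt hT (hl.mem i).1 h ht).2
  have h2 := (integral_eq_of_ae_hasDerivAt hT (hl.mem i).1 h (right_mem_Icc.2 hT)).2
  simp only [intervalIntegral.integral_zero] at h1 h2
  linarith

theorem z_components (hs : IsAdmissible v a T x₀ y₀ θ₀ s u) (hv : v ≠ 0) (hT : 0 < T) {t : ℝ}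
    (ht : t ∈ Icc 0 T) : l t 3 = -s T 4 ∧ l t 4 = -s T 3 ∧ l t 5 = 2 * s T 5 := by
  have h := hl.ae_hasDerivAt hs hv hT
  refine ⟨hl.eq_terminal_of_zero hT.le (i := 3) ?_ ht, hl.eq_terminal_of_zero hT.le (i := 4) ?_ ht,
    hl.eq_terminal_of_zero hT.le (i := 5) ?_ ht⟩
  · exact h.mono fun t h => by simpa using h 3
  · exact h.mono fun t h => by simpa using h 4
  · exact h.mono fun t h => by simpa using h 5

theorem ne_zero (hs : IsAdmissible v a T x₀ y₀ θ₀ s u) (hv : v ≠ 0) (hT : 0 < T) {t : ℝ}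
    (ht : t ∈ Icc 0 T) : l t ≠ 0 := by
  intro h
  obtain ⟨h3, h4, -⟩ := hl.z_components hs hv hT ht
  have := hs.z_sum_pos hv hT
  simp only [h, Pi.zero_apply] at h3 h4
  linarith

/-- The first variation of the terminal cost, expressed by the adjoint function. -/
theorem first_variation_eq (hs : IsAdmissible v a T x₀ y₀ θ₀ s u) (hv : v ≠ 0) (hT : 0 < T)
    (hw : Measurable w) (hwb : ∀ t, w t ∈ Icc (-(v * a)) (v * a)) :
    IntervalIntegrable (fun t => l t 2 * ((w t - u t) / v)) volume 0 T ∧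
    ∫ t in (0 : ℝ)..T, l t 2 * ((w t - u t) / v) =
      ∫ t in (0 : ℝ)..T, pathRateVar v T x₀ y₀ (heading T s)
        (fun τ => headingVar v u w (clamp T τ)) (-s T 4) (-s T 3) (2 * s T 5) 0 t := by
  have hh := continuous_heading hT.le hs.state_mem
  have hd := hs.continuous_headingVar hT.le hw hwb
  have hac := hs.headingVar_ac hT.le hw hwb
  have hder := hs.headingVar_ae_hasDerivAt hT.le hw hwb
  have hD0 : headingVar v u w 0 = 0 := by simp [headingVar]
  have hdD : ∀ t ∈ Icc 0 T, headingVar v u w (clamp T t) = headingVar v u w t := fun t ht => by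
    rw [clamp_of_mem ht]
  set D := headingVar v u w
  set d : ℝ → ℝ := fun τ => D (clamp T τ)
  set X := varX v (heading T s) d 0
  set Y := varY v (heading T s) d 0
  have hX : ∀ t, HasDerivAt X _ t := hasDerivAt_varX_time hh hd 0
  have hY : ∀ t, HasDerivAt Y _ t := hasDerivAt_varY_time hh hd 0
  set G := pathRateVar v T x₀ y₀ (heading T s) d (-s T 4) (-s T 3) (2 * s T 5) 0 with hG
  have hGi : IntervalIntegrable G volume 0 T := by
    refine (continuous_pathRateVar hh hd _ _ _ fun t => ?_).intervalIntegrable _ _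
    rw [← hs.x_eq hT.le d (clamp_mem hT.le t), ← hs.y_eq hT.le d (clamp_mem hT.le t)]
    exact hs.ne_zero hv hT (clamp_mem hT.le t)
  -- The pairing omits the `z`-components: their contribution is exactly `G`. In the derivative the
  -- terms `λ_x X' + λ_y Y'` cancel against `λ_θ' D`.
  have hP : AbsolutelyContinuousOnInterval (fun t => l t 0 * X t + l t 1 * Y t + l t 2 * D t) 0 T :=
    (((hl.mem 0).1.fun_mul (w12_of_continuous_deriv hX (by fun_prop)).1).fun_add
      ((hl.mem 1).1.fun_mul (w12_of_continuous_deriv hY (by fun_prop)).1)).fun_add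
        ((hl.mem 2).1.fun_mul hac)
  have hPd : ∀ᵐ t ∂volume.restrict (Icc 0 T),
      HasDerivAt (fun t => l t 0 * X t + l t 1 * Y t + l t 2 * D t)
        (l t 2 * ((w t - u t) / v) - G t) t := by
    filter_upwards [hl.ae_hasDerivAt hs hv hT, hder, ae_restrict_mem measurableSet_Icc]
      with t h1 h2 ht
    refine ((((h1 0).fun_mul (hX t)).fun_add ((h1 1).fun_mul (hY t))).fun_add
      ((h1 2).fun_mul h2)).congr_deriv ?_
    obtain ⟨h3, h4, h5⟩ := hl.z_components hs hv hT ht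
    have hdt : d t = D t := hdD t ht
    have hθt : heading T s t = s t 2 := by rw [heading, clamp_of_mem ht]
    simp only [Matrix.cons_val, hG, pathRateVar, clamp_of_mem ht, ← hs.x_eq hT.le d ht,
      ← hs.y_eq hT.le d ht, h3, h4, h5, hdt, hθt, zero_mul, add_zero, X, Y]
    ring
  obtain ⟨hi, hint⟩ := integral_eq_of_ae_hasDerivAt hT.le hP hPd (right_mem_Icc.2 hT.le)
  have hX0 : X 0 = 0 := by simp [X, varX]
  have hY0 : Y 0 = 0 := by simp [Y, varY]
  have hlT : ∀ i, l T i = ![0, 0, 0, -s T 4, -s T 3, 2 * s T 5] i := fun i => by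
    rw [← partialDeriv_terminalCost, hl.terminal]
  have h0 := hlT 0
  have h1 := hlT 1
  have h2 := hlT 2
  simp only [Matrix.cons_val] at h0 h1 h2
  -- No boundary terms remain: the variation vanishes at `0`, the three costates at `T`.
  simp only [h0, h1, h2, hX0, hY0, hD0] at hint
  have hsum := hi.add hGi
  simp only [sub_add_cancel] at hsum
  refine ⟨hsum, ?_⟩
  rw [intervalIntegral.integral_sub hsum hGi] at hint
  linarith

end IsAdjoint

/-! ### The minimum condition -/

theorem hamiltonian_sub (v : ℝ) (s l : Fin 6 → ℝ) (w w' : ℝ) :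
    hamiltonian v s w' l - hamiltonian v s w l = l 2 * (w' - w) / v := by
  unfold hamiltonian; ring

/-- The control that minimizes the Hamiltonian for the costate `x` of the heading. -/
noncomputable def bangBang (b x : ℝ) : ℝ := if x < 0 then b else if 0 < x then -b else 0

theorem measurable_bangBang (b : ℝ) : Measurable (bangBang b) :=
  Measurable.ite measurableSet_Iio measurable_const
    (Measurable.ite measurableSet_Ioi measurable_const measurable_const)

theorem bangBang_mem {b : ℝ} (hb : 0 ≤ b) (x : ℝ) : bangBang b x ∈ Icc (-b) b := by
  unfold bangBang
  split_ifs <;> constructor <;> linarith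

theorem mul_bangBang_sub_nonpos {b x w : ℝ} (hw : w ∈ Icc (-b) b) :
    x * (bangBang b x - w) ≤ 0 := by
  unfold bangBang
  split_ifs with h1 h2
  · exact mul_nonpos_of_nonpos_of_nonneg h1.le (by linarith [hw.2])
  · exact mul_nonpos_of_nonneg_of_nonpos h2.le (by linarith [hw.1])
  · simp [le_antisymm (not_lt.1 h2) (not_lt.1 h1)]

/-- Against the bang-bang comparison control the integrand of the first variation is nonpositive
while its integral is nonnegative. -/
theorem IsOptimal.ae_mul_bangBang_sub_eq_zero (hopt : IsOptimal v a T x₀ y₀ θ₀ s u) (hv : 0 < v)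
    (ha : 0 < a) (hT : 0 < T) (hl : IsAdjoint v T s u l) :
    ∀ᵐ t ∂volume.restrict (Icc 0 T), l t 2 * (bangBang (v * a) (l t 2) - u t) = 0 := by
  have hs := hopt.1
  set w : ℝ → ℝ := fun t => bangBang (v * a) (l (clamp T t) 2) with hw_def
  have hw : Measurable w := (measurable_bangBang _).comp
    (continuous_comp_clamp hT.le (hl.mem.continuousOn hT.le 2)).measurable
  have hwb : ∀ t, w t ∈ Icc (-(v * a)) (v * a) := fun t => bangBang_mem (by positivity) _
  have hnonneg := hopt.first_variation_nonneg hT hv hw hwb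
  obtain ⟨hi, heq⟩ := hl.first_variation_eq hs hv.ne' hT hw hwb
  rw [← heq, intervalIntegral.integral_of_le hT.le, ← integral_Icc_eq_integral_Ioc] at hnonneg
  rw [intervalIntegrable_iff_integrableOn_Icc_of_le hT.le] at hi
  have hle : ∀ᵐ t ∂volume.restrict (Icc 0 T), l t 2 * ((w t - u t) / v) ≤ 0 := by
    filter_upwards [hs.bound, ae_restrict_mem measurableSet_Icc] with t hb ht
    rw [← mul_div_assoc, hw_def]
    simp only [clamp_of_mem ht]
    exact div_nonpos_of_nonpos_of_nonneg (mul_bangBang_sub_nonpos hb) hv.le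
  have hzero := (integral_eq_zero_iff_of_nonneg_ae (hle.mono fun t h => neg_nonneg.2 h) hi.neg).1
    (by
      have := integral_nonpos_of_ae hle
      simp only [integral_neg]
      linarith)
  filter_upwards [hzero, ae_restrict_mem measurableSet_Icc] with t h ht
  simp only [Pi.zero_apply, neg_eq_zero, hw_def, clamp_of_mem ht,
    ← mul_div_assoc, div_eq_zero_iff, hv.ne', or_false] at h
  exact h

end Adjoint

end Bearings

theorem proposition1 (v a T x₀ y₀ θ₀ : ℝ) (hv : 0 < v) (ha : 0 < a) (hT : 0 < T)
    (s : ℝ → Fin 6 → ℝ) (u : ℝ → ℝ) (hopt : Bearings.IsOptimal v a T x₀ y₀ θ₀ s u) :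
    (∃ l : ℝ → Fin 6 → ℝ, Bearings.IsAdjoint v T s u l) ∧
    ∀ l : ℝ → Fin 6 → ℝ, Bearings.IsAdjoint v T s u l →
      (∀ t ∈ Set.Icc 0 T, l t ≠ 0) ∧
      ∀ᵐ t ∂MeasureTheory.volume.restrict (Set.Icc 0 T),
        Bearings.MinimizesHamiltonian v a (s t) (l t) (u t) ∧
        (l t 2 < 0 → u t = v * a) ∧
        (0 < l t 2 → u t = -(v * a)) ∧
        (l t 2 = 0 → ∀ w ∈ Set.Icc (-(v * a)) (v * a),
          Bearings.MinimizesHamiltonian v a (s t) (l t) w) := by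
  refine ⟨hopt.1.exists_isAdjoint hv.ne' hT, fun l hl => ⟨fun t ht =>
    hl.ne_zero hopt.1 hv.ne' hT ht, ?_⟩⟩
  filter_upwards [hopt.ae_mul_bangBang_sub_eq_zero hv ha hT hl, hopt.1.bound] with t h hb
  refine ⟨⟨hb, fun w hw => ?_⟩, fun h2 => ?_, fun h2 => ?_, fun h2 w hw => ⟨hw, fun w' _ => ?_⟩⟩
  · rw [← sub_nonneg, Bearings.hamiltonian_sub]
    -- By `h`, the product of `λ_θ` with `u` equals its product with the bang-bang value, so the
    -- latter's minimality passes to `u`.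
    have := Bearings.mul_bangBang_sub_nonpos (x := l t 2) hw
    exact div_nonneg (by linarith) hv.le
  · simp only [Bearings.bangBang, if_pos h2, mul_eq_zero, h2.ne, false_or] at h
    linarith
  · simp only [Bearings.bangBang, if_neg h2.le.not_gt, if_pos h2, mul_eq_zero, h2.ne',
      false_or] at h
    linarith
  · rw [← sub_nonneg, Bearings.hamiltonian_sub, h2]
    simp
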